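/- Let $a$ and $b$ be integers with $4\le b<a$. Then there exists a finite simple $2$-connected graph $G$ (connected, with at least three vertices and no cut vertex) such that $\dim(G)=a$ and $\mathrm{edim}(G)=b$. Here $\dim(G)$, the metric dimension, is the minimum cardinality of a set $S\subseteq V(G)$ such that for any two distinct vertices $x,y$ of $G$ there is $v\in S$ with $d_G(x,v)\ne d_G(y,v)$; and $\mathrm{edim}(G)$, the edge metric dimension, is the minimum cardinality of a set $S\subseteq V(G)$ such that for any two distinct edges $e,f$ of $G$ there is $v\in S$ with $d_G(e,v)\ne d_G(f,v)$, where $d_G(xy,v)=\min\{d_G(x,v),d_G(y,v)\}$ for an edge $xy$. -/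

import Mathlib

namespace SimpleGraph

variable {V : Type*}

/-- `G` is 2-connected: it has at least three vertices, is connected, and has no cut vertex
(deleting any one vertex leaves a connected graph). -/
def IsTwoConnected (G : SimpleGraph V) : Prop :=
  3 ≤ Nat.card V ∧ G.Connected ∧ ∀ v : V, (G.induce {v}ᶜ).Connected

/-- `S` is a metric generator: any two distinct vertices have different distances to some
vertex of `S`. -/
def IsMetricGenerator (G : SimpleGraph V) (S : Finset V) : Prop :=
  ∀ x y : V, x ≠ y → ∃ v ∈ S, G.dist x v ≠ G.dist y v

/-- The metric dimension: the smallest cardinality of a metric generator. -/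
noncomputable def metricDim (G : SimpleGraph V) : ℕ :=
  sInf {k : ℕ | ∃ S : Finset V, G.IsMetricGenerator S ∧ S.card = k}

/-- The distance between an edge `e = xy` and a vertex `v`: the minimum of the distances from
`x` to `v` and from `y` to `v`. -/
noncomputable def edgeDist (G : SimpleGraph V) (e : Sym2 V) (v : V) : ℕ :=
  Sym2.lift ⟨fun x y => min (G.dist x v) (G.dist y v), fun _ _ => min_comm _ _⟩ e

/-- `S` is an edge metric generator: any two distinct edges have different distances to some
vertex of `S`. -/
def IsEdgeMetricGenerator (G : SimpleGraph V) (S : Finset V) : Prop :=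
  ∀ e ∈ G.edgeSet, ∀ f ∈ G.edgeSet, e ≠ f → ∃ v ∈ S, G.edgeDist e v ≠ G.edgeDist f v

/-- The edge metric dimension: the smallest cardinality of an edge metric generator. -/
noncomputable def edgeMetricDim (G : SimpleGraph V) : ℕ :=
  sInf {k : ℕ | ∃ S : Finset V, G.IsEdgeMetricGenerator S ∧ S.card = k}

end SimpleGraph

/-! Put n = a - b and m = b. The graph is a modified 3 × (3n + 4) grid. Its upper left corner is
cloned into m twins and its upper right corner into two; any generator, for vertices or for edges,
misses at most one vertex of each twin class, so it needs m of these vertices.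

They suffice for edges. In a grid, the distances to the two upper corners determine a vertex, and
they also determine an edge, because the parity of their sum tells horizontal from vertical. Each of
n middle vertices is split into a copy carrying the vertical edges and a copy carrying the
horizontal ones. Splitting a vertex in this way does not put two edges in one grid position, so
edges stay distinguished.

Vertices do not: the two copies of a split vertex are told apart only by themselves and their
neighbours. These n neighbourhoods are disjoint and avoid the cloned corners, so the metric
dimension is at least m + n; adding one copy from each pair attains it.

In the middle row the copy indices along a horizontal edge add up to 1, so only split vertices keep
horizontal edges there. This keeps the resolving neighbourhoods small. The middle vertices of the
second and last but one columns are deleted because they, or edges at them, would have the same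
corner distances as the extra corner clones or their edges. -/

namespace SimpleGraph

variable {V : Type*} {G : SimpleGraph V}

/-! ### Distances and 2-connectedness in general graphs -/

theorem Connected.exists_adj_dist_add_one (hG : G.Connected) {u v : V} (h : u ≠ v) :
    ∃ w, G.Adj u w ∧ G.dist w v + 1 = G.dist u v := by
  obtain ⟨p, hp⟩ := hG.exists_walk_length_eq_dist u v
  cases p with
  | nil => exact absurd rfl h
  | @cons _ w _ huw p =>
    refine ⟨w, huw, ?_⟩
    have h1 := G.dist_le p
    have h2 := hG.dist_triangle (u := u) (v := w) (w := v)
    rw [dist_eq_one_iff_adj.2 huw] at h2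
    rw [Walk.length_cons] at hp
    omega

theorem Reachable.of_descent {r : V} (g : V → ℕ)
    (h : ∀ u, u ≠ r → ∃ w, G.Adj u w ∧ g w < g u) (u : V) : G.Reachable u r := by
  induction hk : g u using Nat.strong_induction_on generalizing u with
  | _ k ih =>
    by_cases hu : u = r
    · exact hu ▸ Reachable.refl _
    · obtain ⟨w, hw, hlt⟩ := h u hu
      exact hw.reachable.trans (ih _ (hk ▸ hlt) w rfl)

/-- A function that vanishes at `r`, changes by at most one along edges, and decreases along some
edge out of every other vertex, is the distance to `r`. -/
theorem dist_eq_of_potential (hG : G.Connected) {r : V} (f : V → ℕ) (hr : f r = 0)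
    (hlip : ∀ u w, G.Adj u w → f u ≤ f w + 1)
    (hdesc : ∀ u, u ≠ r → ∃ w, G.Adj u w ∧ f w + 1 = f u) (u : V) : G.dist u r = f u := by
  apply le_antisymm
  · induction hk : f u generalizing u with
    | zero =>
      by_cases hu : u = r
      · simp [hu]
      · obtain ⟨w, _, h⟩ := hdesc u hu
        omega
    | succ k ih =>
      obtain ⟨w, hw, h⟩ := hdesc u (by rintro rfl; omega)
      have h1 := ih w (by omega)
      have h2 := hG.dist_triangle (u := u) (v := w) (w := r)
      rw [dist_eq_one_iff_adj.2 hw] at h2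
      omega
  · obtain ⟨p, hp⟩ := hG.exists_walk_length_eq_dist u r
    rw [← hp]
    clear hp
    induction p with
    | nil => simp [hr]
    | cons h p ih =>
      have := hlip _ _ h
      have := ih hr hdesc
      rw [Walk.length_cons]
      omega

/-- Vertices with the same neighbours have the same distance to every other vertex. -/
theorem dist_le_dist_of_adj_imp (hG : G.Connected) {t t' v : V}
    (h : ∀ w, G.Adj t w → G.Adj t' w) (hv : v ≠ t) : G.dist t' v ≤ G.dist t v := by
  obtain ⟨w, hw, hd⟩ := hG.exists_adj_dist_add_one hv.symm
  have h2 := hG.dist_triangle (u := t') (v := w) (w := v)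
  rw [dist_eq_one_iff_adj.2 (h w hw)] at h2
  omega

/-- A geodesic from `x` to `v` has at least two steps, and its first two can be replaced by two
steps from `y`. It never returns to `x`, hence the restriction on `q`. -/
theorem dist_le_dist_of_two_step (hG : G.Connected) {x y v : V}
    (h : ∀ p q, G.Adj x p → G.Adj p q → q ≠ x → ∃ p', G.Adj y p' ∧ G.Adj p' q)
    (hv : v ≠ x) (hv' : ¬ G.Adj x v) : G.dist y v ≤ G.dist x v := by
  obtain ⟨p, hp, hd⟩ := hG.exists_adj_dist_add_one hv.symm
  obtain ⟨q, hq, hd'⟩ := hG.exists_adj_dist_add_one (u := p) (v := v)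
    (by rintro rfl; exact hv' hp)
  obtain ⟨p', h1, h2⟩ := h p q hp hq (by rintro rfl; omega)
  have h3 := hG.dist_triangle (u := y) (v := p') (w := v)
  have h4 := hG.dist_triangle (u := p') (v := q) (w := v)
  rw [dist_eq_one_iff_adj.2 h1] at h3
  rw [dist_eq_one_iff_adj.2 h2] at h4
  omega

/-- A graph with an `st`-numbering `g` is connected and has no cut vertex. -/
theorem connected_induce_compl_of_numbering (g : V → ℕ) {s t : V} (hst : G.Adj s t)
    (hdown : ∀ u, u ≠ s → ∃ w, G.Adj u w ∧ g w < g u)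
    (hup : ∀ u, u ≠ t → ∃ w, G.Adj u w ∧ g u < g w)
    (hbdd : ∃ N, ∀ u, g u ≤ N) (v : V) : (G.induce {v}ᶜ).Connected := by
  obtain ⟨N, hN⟩ := hbdd
  -- A strictly descending path that starts no higher than `v` cannot meet `v`. Dually, `up` ascends
  -- from above `v`, and the edge `s t` joins the two ends.
  have down : ∀ k (u : ({v}ᶜ : Set V)), g u = k → g u ≤ g v →
      ∃ hs : s ∈ ({v}ᶜ : Set V), (G.induce {v}ᶜ).Reachable u ⟨s, hs⟩ := by
    intro k
    induction k using Nat.strong_induction_on with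
    | _ k ih =>
      intro u hu hv
      by_cases h : u.1 = s
      · exact ⟨h ▸ u.2, by subst h; exact Reachable.refl _⟩
      · obtain ⟨w, hw, hlt⟩ := hdown u h
        have hwv : w ∈ ({v}ᶜ : Set V) := by
          rintro rfl
          omega
        obtain ⟨hs, hr⟩ := ih (g w) (by omega) ⟨w, hwv⟩ rfl (by simp; omega)
        exact ⟨hs, Reachable.trans (Adj.reachable (by simpa using hw)) hr⟩
  have up : ∀ k (u : ({v}ᶜ : Set V)), N - g u = k → g v < g u →
      ∃ ht : t ∈ ({v}ᶜ : Set V), (G.induce {v}ᶜ).Reachable u ⟨t, ht⟩ := by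
    intro k
    induction k using Nat.strong_induction_on with
    | _ k ih =>
      intro u hu hv
      by_cases h : u.1 = t
      · exact ⟨h ▸ u.2, by subst h; exact Reachable.refl _⟩
      · obtain ⟨w, hw, hlt⟩ := hup u h
        have hwv : w ∈ ({v}ᶜ : Set V) := by
          rintro rfl
          omega
        have := hN w
        obtain ⟨hs, hr⟩ := ih (N - g w) (by omega) ⟨w, hwv⟩ rfl (by simp; omega)
        exact ⟨hs, Reachable.trans (Adj.reachable (by simpa using hw)) hr⟩
  have either : ∀ u : ({v}ᶜ : Set V),
      (∃ hs : s ∈ ({v}ᶜ : Set V), (G.induce {v}ᶜ).Reachable u ⟨s, hs⟩) ∨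
      ∃ ht : t ∈ ({v}ᶜ : Set V), (G.induce {v}ᶜ).Reachable u ⟨t, ht⟩ := fun u =>
    (le_or_gt (g u) (g v)).imp (down _ u rfl) (up _ u rfl)
  have : Nonempty ({v}ᶜ : Set V) := by
    by_cases h : s = v
    · exact ⟨⟨t, fun h' => hst.ne (h.trans h'.symm)⟩⟩
    · exact ⟨⟨s, h⟩⟩
  refine ⟨fun u w => ?_⟩
  rcases either u with ⟨h1, hu⟩ | ⟨h1, hu⟩ <;> rcases either w with ⟨h2, hw⟩ | ⟨h2, hw⟩
  · exact hu.trans hw.symm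
  · exact hu.trans ((Adj.reachable (by simpa using hst)).trans hw.symm)
  · exact hu.trans ((Adj.reachable (by simpa using hst.symm)).trans hw.symm)
  · exact hu.trans hw.symm

/-! ### Twins and counting -/

theorem dist_eq_dist_of_twins (hG : G.Connected) {t t' v : V}
    (h : ∀ w, G.Adj t w ↔ G.Adj t' w) (hv : v ≠ t) (hv' : v ≠ t') : G.dist t v = G.dist t' v :=
  le_antisymm (dist_le_dist_of_adj_imp hG (fun w => (h w).2) hv')
    (dist_le_dist_of_adj_imp hG (fun w => (h w).1) hv)

theorem IsMetricGenerator.eq_of_twins (hG : G.Connected) {S : Finset V} (hS : G.IsMetricGenerator S)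
    {t t' : V} (h : ∀ w, G.Adj t w ↔ G.Adj t' w) (ht : t ∉ S) (ht' : t' ∉ S) : t = t' := by
  by_contra hne
  obtain ⟨v, hv, hd⟩ := hS t t' hne
  exact hd (dist_eq_dist_of_twins hG h (by rintro rfl; exact ht hv) (by rintro rfl; exact ht' hv))

theorem edgeDist_mk (G : SimpleGraph V) (x y v : V) :
    G.edgeDist s(x, y) v = min (G.dist x v) (G.dist y v) := rfl

theorem IsEdgeMetricGenerator.eq_of_twins (hG : G.Connected) {S : Finset V}
    (hS : G.IsEdgeMetricGenerator S) {t t' w : V} (h : ∀ w, G.Adj t w ↔ G.Adj t' w)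
    (hw : G.Adj t w) (ht : t ∉ S) (ht' : t' ∉ S) : t = t' := by
  by_contra hne
  obtain ⟨v, hv, hd⟩ := hS s(t, w) hw s(t', w) ((h w).1 hw) fun h => hne (Sym2.congr_left.1 h)
  rw [edgeDist_mk, edgeDist_mk, dist_eq_dist_of_twins hG h (by rintro rfl; exact ht hv)
    (by rintro rfl; exact ht' hv)] at hd
  exact hd rfl

end SimpleGraph

theorem Nat.sInf_eq_of_mem_of_le {s : Set ℕ} {k l : ℕ} (hl : l ∈ s) (hlk : l ≤ k)
    (h : ∀ x ∈ s, k ≤ x) : sInf s = k :=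
  le_antisymm ((Nat.sInf_le hl).trans hlk) (le_csInf ⟨l, hl⟩ h)

/-- If `S` omits at most one of the `m` elements `t i`, all labelled `0`, and contains elements with
labels `1, …, N`, then `S` has at least `m - 1 + N` elements. -/
theorem Finset.le_card_of_labels {V : Type*} [DecidableEq V] (S : Finset V) (lab : V → ℕ) {m : ℕ}
    (t : Fin m → V) (ht : Function.Injective t) (hlab : ∀ i, lab (t i) = 0)
    (hmiss : ∀ i j, t i ∉ S → t j ∉ S → i = j) (N : ℕ)
    (hw : ∀ j < N, ∃ w ∈ S, lab w = j + 1) : m - 1 + N ≤ S.card := by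
  rw [← Finset.card_filter_add_card_filter_not (s := S) (fun v => lab v = 0)]
  apply Nat.add_le_add
  · have h1 : (Finset.univ.filter fun i => t i ∉ S).card ≤ 1 := by
      refine Finset.card_le_one.2 fun i hi j hj => ?_
      simp only [Finset.mem_filter, Finset.mem_univ, true_and] at hi hj
      exact hmiss i j hi hj
    have h2 := Finset.card_filter_add_card_filter_not (s := (Finset.univ : Finset (Fin m)))
      (fun i => t i ∈ S)
    have h3 : (Finset.univ.filter fun i => t i ∈ S).card ≤ (S.filter fun v => lab v = 0).card := by
      refine Finset.card_le_card_of_injOn t (fun i hi => ?_) ht.injOn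
      simpa [hlab] using hi
    rw [Finset.card_univ, Fintype.card_fin] at h2
    omega
  · have h : (Finset.range N).image Nat.succ ⊆ (S.filter fun v => ¬ lab v = 0).image lab := by
      intro k hk
      obtain ⟨j, hj, rfl⟩ := Finset.mem_image.1 hk
      obtain ⟨w, hwS, hl⟩ := hw j (Finset.mem_range.1 hj)
      exact Finset.mem_image.2 ⟨w, Finset.mem_filter.2 ⟨hwS, by omega⟩, hl⟩
    calc N = ((Finset.range N).image Nat.succ).card := by
            rw [Finset.card_image_of_injective _ Nat.succ_injective, Finset.card_range]
      _ ≤ _ := Finset.card_le_card h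
      _ ≤ _ := Finset.card_image_le

/-! ### The split grid and its 2-connectedness -/

namespace SplitGrid

open SimpleGraph

/-- Admissible triples (column, row, copy) of a grid with three rows and columns `0, …, 3n + 3`:
the corner `(0, 0)` has `m` copies, the corner `(3n + 3, 0)` has two, and so has the middle vertex
of the columns `3, 6, …, 3n`; the second and last but one columns have no middle vertex. -/
def IsVertex (n m : ℕ) (p : ℕ × ℕ × ℕ) : Prop :=
  p.1 ≤ 3 * n + 3 ∧
    ((p.2.1 = 0 ∧ (p.2.2 = 0 ∨ p.1 = 0 ∧ p.2.2 < m ∨ p.1 = 3 * n + 3 ∧ p.2.2 < 2)) ∨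
    (p.2.1 = 1 ∧ (p.2.2 = 0 ∧ p.1 ≠ 1 ∧ p.1 ≠ 3 * n + 2 ∨
      p.2.2 = 1 ∧ p.1 % 3 = 0 ∧ 0 < p.1 ∧ p.1 < 3 * n + 3)) ∨
    (p.2.1 = 2 ∧ p.2.2 = 0))

abbrev Vertex (n m : ℕ) : Type := {p : ℕ × ℕ × ℕ // IsVertex n m p}

instance (n m : ℕ) : Finite (Vertex n m) := by
  refine Set.Finite.subset (s := (↑(Finset.range (3 * n + 4) ×ˢ Finset.range 3 ×ˢ
    Finset.range (m + 2)) : Set (ℕ × ℕ × ℕ))) (Finset.finite_toSet _) ?_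
  rintro ⟨c, r, k⟩ h
  change IsVertex n m _ at h
  simp only [IsVertex] at h
  simp only [Finset.coe_product, Set.mem_prod, Finset.mem_coe, Finset.mem_range]
  omega

/-- One step to the right or down. The copy `0` of a split middle vertex has vertical edges only,
the copy `1` horizontal ones only. -/
def Arrow (p q : ℕ × ℕ × ℕ) : Prop :=
  (q.2.1 = p.2.1 ∧ q.1 = p.1 + 1 ∧ (p.2.1 = 1 → p.2.2 + q.2.2 = 1)) ∨
    (q.1 = p.1 ∧ q.2.1 = p.2.1 + 1 ∧ (p.2.1 = 0 → q.2.2 = 0) ∧ (p.2.1 = 1 → p.2.2 = 0))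

/-- The grid with split vertices. -/
def graph (n m : ℕ) : SimpleGraph (Vertex n m) where
  Adj u v := Arrow u.1 v.1 ∨ Arrow v.1 u.1
  symm := ⟨fun _ _ h => h.symm⟩
  loopless := ⟨fun u h => by simp only [Arrow] at h; omega⟩

variable {n m : ℕ}

theorem adj_iff {u v : Vertex n m} : (graph n m).Adj u v ↔ Arrow u.1 v.1 ∨ Arrow v.1 u.1 := Iff.rfl

def leftCorner (j : ℕ) (h : j < m) : Vertex n m := ⟨(0, 0, j), by simp [IsVertex, h]⟩

def rightCorner (j : ℕ) (h : j < 2) : Vertex n m := ⟨(3 * n + 3, 0, j), by simp [IsVertex, h]⟩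

def splitVertex (i j : ℕ) (hi : i < n) (hj : j < 2) : Vertex n m :=
  ⟨(3 * i + 3, 1, j), by simp [IsVertex]; omega⟩

/-- An `st`-numbering running along the top row, then through the middle, then back along the
bottom row. -/
def numbering (n : ℕ) (p : ℕ × ℕ × ℕ) : ℕ :=
  if p.2.1 = 0 then p.1 + 2
  else if p.2.1 = 1 then
    if p.1 = 0 then 1 else if p.2.2 = 1 then 3 * n + 7
    else if p.1 % 3 = 1 then 3 * n + 8 else 3 * n + 6
  else if p.1 = 0 then 0 else 6 * n + 20 - p.1

theorem numbering_down (u : Vertex n m) (hu : u.1 ≠ (0, 2, 0)) :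
    ∃ w, (graph n m).Adj u w ∧ numbering n w.1 < numbering n u.1 := by
  obtain ⟨⟨c, r, k⟩, h⟩ := u
  simp only [ne_eq, Prod.mk.injEq] at hu
  have h' := h
  simp only [IsVertex] at h'
  obtain ⟨hc, ⟨rfl, hk⟩ | ⟨rfl, hk⟩ | ⟨rfl, rfl⟩⟩ := h'
  · by_cases h0 : c = 0
    · exact ⟨⟨(0, 1, 0), by simp [IsVertex]⟩, by simp [adj_iff, Arrow]; omega,
        by simp [numbering]⟩
    · exact ⟨⟨(c - 1, 0, 0), by simp [IsVertex]; omega⟩, by simp [adj_iff, Arrow]; omega,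
        by simp [numbering]; omega⟩
  · by_cases h0 : c = 0
    · exact ⟨⟨(0, 2, 0), by simp [IsVertex]⟩, by simp [adj_iff, Arrow]; omega,
        by simp [numbering]; split_ifs; omega⟩
    · by_cases h1 : k = 1
      · exact ⟨⟨(c - 1, 1, 0), by simp [IsVertex]; omega⟩, by simp [adj_iff, Arrow]; omega,
          by simp [numbering]; split_ifs <;> omega⟩
      · exact ⟨⟨(c, 0, 0), by simp [IsVertex]; omega⟩, by simp [adj_iff, Arrow]; omega,
          by simp [numbering]; split_ifs <;> omega⟩
  · by_cases h0 : c = 3 * n + 3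
    · exact ⟨⟨(c, 1, 0), by simp [IsVertex]; omega⟩, by simp [adj_iff, Arrow],
        by simp [numbering]; split_ifs <;> omega⟩
    · exact ⟨⟨(c + 1, 2, 0), by simp [IsVertex]; omega⟩, by simp [adj_iff, Arrow],
        by simp [numbering]; split_ifs <;> omega⟩

theorem numbering_up (u : Vertex n m) (hu : u.1 ≠ (1, 2, 0)) :
    ∃ w, (graph n m).Adj u w ∧ numbering n u.1 < numbering n w.1 := by
  obtain ⟨⟨c, r, k⟩, h⟩ := u
  simp only [ne_eq, Prod.mk.injEq] at hu
  have h' := h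
  simp only [IsVertex] at h'
  obtain ⟨hc, ⟨rfl, hk⟩ | ⟨rfl, hk⟩ | ⟨rfl, rfl⟩⟩ := h'
  · by_cases h0 : c = 3 * n + 3
    · exact ⟨⟨(c, 1, 0), by simp [IsVertex]; omega⟩, by simp [adj_iff, Arrow],
        by simp [numbering]; split_ifs <;> omega⟩
    · exact ⟨⟨(c + 1, 0, 0), by simp [IsVertex]; omega⟩, by simp [adj_iff, Arrow],
        by simp [numbering]⟩
  · by_cases h0 : c = 0
    · exact ⟨⟨(0, 0, 0), by simp [IsVertex]⟩, by simp [adj_iff, Arrow]; omega,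
        by simp [numbering]; split_ifs; omega⟩
    · by_cases h1 : k = 1
      · exact ⟨⟨(c + 1, 1, 0), by simp [IsVertex]; omega⟩, by simp [adj_iff, Arrow]; omega,
          by simp [numbering]; split_ifs <;> omega⟩
      · exact ⟨⟨(c, 2, 0), by simp [IsVertex]; omega⟩, by simp [adj_iff, Arrow]; omega,
          by simp [numbering]; split_ifs <;> omega⟩
  · by_cases h0 : c = 0
    · exact ⟨⟨(1, 2, 0), by simp [IsVertex]⟩, by simp [adj_iff, Arrow]; omega,
        by simp [numbering]; split_ifs; omega⟩
    · exact ⟨⟨(c - 1, 2, 0), by simp [IsVertex]; omega⟩, by simp [adj_iff, Arrow]; omega,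
        by simp [numbering]; split_ifs <;> omega⟩

theorem connected : (graph n m).Connected := by
  have hs : IsVertex n m (0, 2, 0) := by simp [IsVertex]
  have h : ∀ u, (graph n m).Reachable u ⟨_, hs⟩ :=
    Reachable.of_descent (fun u => numbering n u.1) fun u hu =>
      numbering_down u fun h => hu (Subtype.ext h)
  have : Nonempty (Vertex n m) := ⟨⟨_, hs⟩⟩
  exact ⟨fun u v => (h u).trans (h v).symm⟩

theorem isTwoConnected : (graph n m).IsTwoConnected := by
  refine ⟨?_, connected, ?_⟩
  · have hf : Function.Injective (fun r : Fin 3 =>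
        (⟨(0, r, 0), by simp [IsVertex]; omega⟩ : Vertex n m)) := by
      intro r s h
      simp only [Subtype.mk.injEq, Prod.mk.injEq] at h
      omega
    simpa using Nat.card_le_card_of_injective _ hf
  · refine connected_induce_compl_of_numbering (fun u : Vertex n m => numbering n u.1)
      (s := ⟨(0, 2, 0), by simp [IsVertex]⟩) (t := ⟨(1, 2, 0), by simp [IsVertex]⟩)
      (by simp [adj_iff, Arrow]) (fun u hu => numbering_down u fun h => hu (Subtype.ext h))
      (fun u hu => numbering_up u fun h => hu (Subtype.ext h)) ⟨6 * n + 20, fun u => ?_⟩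
    have := u.2.1
    simp only [numbering]
    split_ifs <;> omega

/-! ### Distances to the upper corners -/

/-- The distance to the copy `0` of the left corner. -/
def leftDist (p : ℕ × ℕ × ℕ) : ℕ :=
  if p.1 = 0 ∧ p.2.1 = 0 ∧ p.2.2 ≠ 0 then 2 else p.1 + p.2.1

/-- The distance to the copy `0` of the right corner. -/
def rightDist (n : ℕ) (p : ℕ × ℕ × ℕ) : ℕ :=
  if p.1 = 3 * n + 3 ∧ p.2.1 = 0 ∧ p.2.2 ≠ 0 then 2 else 3 * n + 3 - p.1 + p.2.1

theorem dist_leftCorner (hm : 0 < m) (u : Vertex n m) :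
    (graph n m).dist u (leftCorner 0 hm) = leftDist u.1 := by
  refine dist_eq_of_potential connected (fun u => leftDist u.1) (by simp [leftDist, leftCorner])
    ?_ ?_ u
  · rintro ⟨⟨c, r, k⟩, h⟩ ⟨⟨c', r', k'⟩, h'⟩ ha
    simp only [adj_iff, Arrow] at ha
    simp only [leftDist]
    split_ifs <;> omega
  · rintro ⟨⟨c, r, k⟩, h⟩ hu
    rw [ne_eq, Subtype.ext_iff] at hu
    simp only [leftCorner, Prod.mk.injEq] at hu
    have h' := h
    simp only [IsVertex] at h'
    obtain ⟨hc, ⟨rfl, hk⟩ | ⟨rfl, hk⟩ | ⟨rfl, rfl⟩⟩ := h'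
    · by_cases h0 : c = 0
      · exact ⟨⟨(1, 0, 0), by simp [IsVertex]⟩, by simp [adj_iff, Arrow]; omega,
          by simp [leftDist]; omega⟩
      · exact ⟨⟨(c - 1, 0, 0), by simp [IsVertex]; omega⟩, by simp [adj_iff, Arrow]; omega,
          by simp [leftDist]; split_ifs <;> omega⟩
    · by_cases h1 : k = 1
      · exact ⟨⟨(c - 1, 1, 0), by simp [IsVertex]; omega⟩, by simp [adj_iff, Arrow]; omega,
          by simp [leftDist]; omega⟩
      · exact ⟨⟨(c, 0, 0), by simp [IsVertex]; omega⟩, by simp [adj_iff, Arrow]; omega,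
          by simp [leftDist]⟩
    · by_cases h0 : c = 0
      · exact ⟨⟨(0, 1, 0), by simp [IsVertex]⟩, by simp [adj_iff, Arrow]; omega,
          by simp [leftDist]; omega⟩
      · exact ⟨⟨(c - 1, 2, 0), by simp [IsVertex]; omega⟩, by simp [adj_iff, Arrow]; omega,
          by simp [leftDist]; omega⟩

theorem dist_rightCorner (u : Vertex n m) :
    (graph n m).dist u (rightCorner 0 two_pos) = rightDist n u.1 := by
  refine dist_eq_of_potential connected (fun u => rightDist n u.1)
    (by simp [rightDist, rightCorner]) ?_ ?_ u
  · rintro ⟨⟨c, r, k⟩, h⟩ ⟨⟨c', r', k'⟩, h'⟩ ha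
    simp only [adj_iff, Arrow] at ha
    simp only [rightDist]
    have := h.1
    have := h'.1
    split_ifs <;> omega
  · rintro ⟨⟨c, r, k⟩, h⟩ hu
    rw [ne_eq, Subtype.ext_iff] at hu
    simp only [rightCorner, Prod.mk.injEq] at hu
    have h' := h
    simp only [IsVertex] at h'
    obtain ⟨hc, ⟨rfl, hk⟩ | ⟨rfl, hk⟩ | ⟨rfl, rfl⟩⟩ := h'
    · by_cases h0 : c = 3 * n + 3
      · exact ⟨⟨(c - 1, 0, 0), by simp [IsVertex]; omega⟩, by simp [adj_iff, Arrow]; omega,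
          by simp [rightDist]; split_ifs <;> omega⟩
      · exact ⟨⟨(c + 1, 0, 0), by simp [IsVertex]; omega⟩, by simp [adj_iff, Arrow],
          by simp [rightDist]; split_ifs <;> omega⟩
    · by_cases h1 : k = 1
      · exact ⟨⟨(c + 1, 1, 0), by simp [IsVertex]; omega⟩, by simp [adj_iff, Arrow]; omega,
          by simp [rightDist]; omega⟩
      · exact ⟨⟨(c, 0, 0), by simp [IsVertex]; omega⟩, by simp [adj_iff, Arrow]; omega,
          by simp [rightDist]⟩
    · by_cases h0 : c = 3 * n + 3
      · exact ⟨⟨(c, 1, 0), by simp [IsVertex]; omega⟩, by simp [adj_iff, Arrow],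
          by simp [rightDist]⟩
      · exact ⟨⟨(c + 1, 2, 0), by simp [IsVertex]; omega⟩, by simp [adj_iff, Arrow],
          by simp [rightDist]; omega⟩

theorem leftCorner_adj_iff (i j : ℕ) (hi : i < m) (hj : j < m) (w : Vertex n m) :
    (graph n m).Adj (leftCorner i hi) w ↔ (graph n m).Adj (leftCorner j hj) w := by
  simp [adj_iff, Arrow, leftCorner]

theorem rightCorner_adj_iff (i j : ℕ) (hi : i < 2) (hj : j < 2) (w : Vertex n m) :
    (graph n m).Adj (rightCorner i hi) w ↔ (graph n m).Adj (rightCorner j hj) w := by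
  have := w.2.1
  simp [adj_iff, Arrow, rightCorner]
  omega

theorem leftCorner_adj (i : ℕ) (hi : i < m) :
    (graph n m).Adj (leftCorner i hi) ⟨(1, 0, 0), by simp [IsVertex]⟩ := by
  simp [adj_iff, Arrow, leftCorner]

theorem rightCorner_adj (i : ℕ) (hi : i < 2) :
    (graph n m).Adj (rightCorner i hi) ⟨(3 * n + 2, 0, 0), by simp [IsVertex]⟩ := by
  simp [adj_iff, Arrow, rightCorner]

/-! ### Lower bounds -/

/-- The neighbourhood of a split pair that resolves it. -/
def NearSplit (i : ℕ) (p : ℕ × ℕ × ℕ) : Prop :=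
  3 * i + 2 ≤ p.1 ∧ p.1 ≤ 3 * i + 4 ∧ (p.2.1 = 1 ∨ p.1 = 3 * i + 3)

/-- Both copies reach in two steps the same four vertices, diagonal to them in the grid, and nothing
else new. -/
theorem dist_splitVertex_le {i j j' : ℕ} (hi : i < n) (hj : j < 2) (hj' : j' < 2)
    (hjj : j ≠ j') (v : Vertex n m) (hv : ¬ NearSplit i v.1) :
    (graph n m).dist (splitVertex i j' hi hj') v ≤ (graph n m).dist (splitVertex i j hi hj) v := by
  refine dist_le_dist_of_two_step connected ?_ ?_ ?_
  · rintro ⟨⟨c, r, k⟩, h⟩ ⟨⟨c', r', k'⟩, h'⟩ h1 h2 h3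
    rw [ne_eq, Subtype.ext_iff] at h3
    simp only [adj_iff, Arrow, splitVertex, Prod.mk.injEq, true_imp_iff] at h1 h2 h3
    simp only [IsVertex] at h h'
    have hcorner : (c' = 3 * i + 2 ∨ c' = 3 * i + 4) ∧ (r' = 0 ∨ r' = 2) ∧ k' = 0 := by omega
    obtain rfl | rfl : j' = 0 ∨ j' = 1 := by omega
    · exact ⟨⟨(3 * i + 3, r', 0), by simp [IsVertex]; omega⟩,
        by simp [adj_iff, Arrow, splitVertex]; omega, by simp [adj_iff, Arrow]; omega⟩
    · exact ⟨⟨(c', 1, 0), by simp [IsVertex]; omega⟩,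
        by simp [adj_iff, Arrow, splitVertex]; omega, by simp [adj_iff, Arrow]; omega⟩
  · rintro rfl
    simp [NearSplit, splitVertex] at hv
  · intro h
    simp only [adj_iff, Arrow, splitVertex, NearSplit] at h hv
    omega

theorem exists_mem_nearSplit {S : Finset (Vertex n m)}
    (hS : (graph n m).IsMetricGenerator S) {i : ℕ} (hi : i < n) : ∃ v ∈ S, NearSplit i v.1 := by
  obtain ⟨v, hv, hd⟩ := hS (splitVertex i 0 hi two_pos) (splitVertex i 1 hi one_lt_two)
    (by simp [splitVertex])
  refine ⟨v, hv, ?_⟩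
  by_contra h
  exact hd (le_antisymm (dist_splitVertex_le hi _ _ one_ne_zero v h)
    (dist_splitVertex_le hi _ _ zero_ne_one v h))

/-- Labels `0` and `1` for the corners, and `i + 2` for the neighbourhood of the `i`-th split
pair. -/
def label (n : ℕ) (p : ℕ × ℕ × ℕ) : ℕ :=
  if p.1 = 0 then 0 else if p.1 = 3 * n + 3 then 1 else (p.1 + 4) / 3

theorem leftCorner_injective :
    Function.Injective fun j : Fin m => (leftCorner j j.2 : Vertex n m) := by
  intro i j h
  rw [Subtype.ext_iff] at h
  simp only [leftCorner, Prod.mk.injEq] at h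
  omega

theorem rightCorner_ne : (rightCorner 0 two_pos : Vertex n m) ≠ rightCorner 1 one_lt_two :=
  fun h => by simpa [rightCorner] using congrArg (fun v : Vertex n m => v.1.2.2) h

theorem le_card_of_isMetricGenerator (hm : 0 < m) {S : Finset (Vertex n m)}
    (hS : (graph n m).IsMetricGenerator S) : m + n ≤ S.card := by
  have := S.le_card_of_labels (fun v => label n v.1) (fun j : Fin m => leftCorner j j.2)
    leftCorner_injective (fun i => by simp [label, leftCorner])
    (fun i j hi hj => leftCorner_injective
      (hS.eq_of_twins connected (leftCorner_adj_iff _ _ _ _) hi hj)) (n + 1) (fun j hj => ?_)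
  · omega
  · cases j with
    | zero =>
      by_contra! h
      exact rightCorner_ne (n := n) (m := m) (hS.eq_of_twins connected
        (rightCorner_adj_iff _ _ _ _) (fun hm => h _ hm (by simp [label, rightCorner]))
        fun hm => h _ hm (by simp [label, rightCorner]))
    | succ i =>
      obtain ⟨v, hv, hn⟩ := exists_mem_nearSplit hS (i := i) (by omega)
      refine ⟨v, hv, ?_⟩
      simp only [NearSplit] at hn
      -- Columns 3i + 2 to 3i + 4 all get label i + 2, and since i < n they avoid both outer
      -- columns.
      simp only [label]
      split_ifs <;> omega

theorem le_card_of_isEdgeMetricGenerator (hm : 0 < m) {S : Finset (Vertex n m)}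
    (hS : (graph n m).IsEdgeMetricGenerator S) : m ≤ S.card := by
  have := S.le_card_of_labels (fun v => label n v.1) (fun j : Fin m => leftCorner j j.2)
    leftCorner_injective (fun i => by simp [label, leftCorner])
    (fun i j hi hj => leftCorner_injective
      (hS.eq_of_twins connected (leftCorner_adj_iff _ _ _ _) (leftCorner_adj _ _) hi hj))
    1 (fun j hj => ?_)
  · omega
  · obtain rfl : j = 0 := by omega
    by_contra! h
    exact rightCorner_ne (n := n) (m := m) (hS.eq_of_twins connected
      (rightCorner_adj_iff _ _ _ _) (rightCorner_adj _ _)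
      (fun hm => h _ hm (by simp [label, rightCorner]))
      fun hm => h _ hm (by simp [label, rightCorner]))

/-! ### Landmarks resolving the vertices -/

/-- All but one copies of the left corner and one copy of the right corner. -/
def cornerLandmarks (n m : ℕ) : Finset (Vertex n m) :=
  insert (rightCorner 0 two_pos)
    (Finset.univ.image fun j : Fin (m - 1) => leftCorner j (by omega))

/-- The corner landmarks together with one vertex of each split pair. -/
def landmarks (n m : ℕ) : Finset (Vertex n m) :=
  cornerLandmarks n m ∪ Finset.univ.image fun i : Fin n => splitVertex i 1 i.2 one_lt_two

theorem card_cornerLandmarks_le (hm : 0 < m) : (cornerLandmarks n m).card ≤ m := by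
  have h1 := Finset.card_insert_le (rightCorner 0 two_pos : Vertex n m)
    (Finset.univ.image fun j : Fin (m - 1) => leftCorner j (by omega))
  have h2 := Finset.card_image_le (s := (Finset.univ : Finset (Fin (m - 1))))
    (f := fun j => (leftCorner j (by omega) : Vertex n m))
  rw [Finset.card_univ, Fintype.card_fin] at h2
  rw [cornerLandmarks]
  omega

theorem card_landmarks_le (hm : 0 < m) : (landmarks n m).card ≤ m + n := by
  have h1 := Finset.card_union_le (cornerLandmarks n m)
    (Finset.univ.image fun i : Fin n => splitVertex i 1 i.2 one_lt_two)
  have h2 := Finset.card_image_le (s := (Finset.univ : Finset (Fin n)))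
    (f := fun i => (splitVertex i 1 i.2 one_lt_two : Vertex n m))
  have h3 := card_cornerLandmarks_le (n := n) hm
  rw [Finset.card_univ, Fintype.card_fin] at h2
  rw [landmarks]
  omega

theorem rightCorner_mem : rightCorner 0 two_pos ∈ cornerLandmarks n m :=
  Finset.mem_insert_self _ _

theorem leftCorner_mem (j : ℕ) (hj : j < m - 1) :
    leftCorner j (by omega) ∈ cornerLandmarks n m :=
  Finset.mem_insert_of_mem (Finset.mem_image.2 ⟨⟨j, hj⟩, Finset.mem_univ _, rfl⟩)

theorem mem_landmarks_of_corner {v : Vertex n m} (h : v ∈ cornerLandmarks n m) :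
    v ∈ landmarks n m := Finset.mem_union_left _ h

theorem splitVertex_mem (i : ℕ) (hi : i < n) : splitVertex i 1 hi one_lt_two ∈ landmarks n m :=
  Finset.mem_union_right _ (Finset.mem_image.2 ⟨⟨i, hi⟩, Finset.mem_univ _, rfl⟩)

theorem isMetricGenerator_landmarks (hm : 2 ≤ m) :
    (graph n m).IsMetricGenerator (landmarks n m) := by
  intro u v huv
  by_contra! H
  -- A landmark is resolved from everything by itself. So `u` and `v` are not landmarks, which fixes
  -- their copy index wherever there are several copies.
  have key : ∀ w ∈ landmarks n m, u ≠ w ∧ v ≠ w := by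
    intro w hw
    have := H w hw
    constructor <;> rintro rfl
    · rw [dist_self, eq_comm, connected.dist_eq_zero_iff] at this
      exact huv this.symm
    · rw [dist_self, connected.dist_eq_zero_iff] at this
      exact huv this
  have hL := H _ (mem_landmarks_of_corner (leftCorner_mem 0 (by omega)))
  have hR := H _ (mem_landmarks_of_corner rightCorner_mem)
  rw [dist_leftCorner, dist_leftCorner] at hL
  rw [dist_rightCorner, dist_rightCorner] at hR
  have notLeft : ∀ w : Vertex n m, (∀ l ∈ landmarks n m, w ≠ l) → w.1.1 = 0 → w.1.2.1 = 0 →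
      w.1.2.2 = m - 1 := by
    rintro ⟨⟨c, r, k⟩, h⟩ hl hc hr
    dsimp only at hc hr ⊢
    subst hc hr
    by_contra hk
    simp only [IsVertex] at h
    exact hl _ (mem_landmarks_of_corner (leftCorner_mem k (by omega))) rfl
  have notRight : ∀ w : Vertex n m, (∀ l ∈ landmarks n m, w ≠ l) → w.1.1 = 3 * n + 3 →
      w.1.2.1 = 0 → w.1.2.2 = 1 := by
    rintro ⟨⟨c, r, k⟩, h⟩ hl hc hr
    dsimp only at hc hr ⊢
    subst hc hr
    by_contra hk
    simp only [IsVertex] at h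
    obtain rfl : k = 0 := by omega
    exact hl _ (mem_landmarks_of_corner rightCorner_mem) rfl
  have notSplit : ∀ w : Vertex n m, (∀ l ∈ landmarks n m, w ≠ l) → w.1.2.1 = 1 →
      w.1.2.2 = 0 := by
    rintro ⟨⟨c, r, k⟩, h⟩ hl hr
    dsimp only at hr ⊢
    subst hr
    by_contra hk
    have h' := h
    simp only [IsVertex] at h'
    obtain rfl : k = 1 := by omega
    refine hl _ (splitVertex_mem (c / 3 - 1) (by omega)) (Subtype.ext ?_)
    simp only [splitVertex, Prod.mk.injEq, and_true]
    omega
  have hu := fun w hw => (key w hw).1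
  have hv := fun w hw => (key w hw).2
  have u1 := notLeft u hu
  have u2 := notRight u hu
  have u3 := notSplit u hu
  have v1 := notLeft v hv
  have v2 := notRight v hv
  have v3 := notSplit v hv
  clear notLeft notRight notSplit hu hv key H
  refine huv (Subtype.ext ?_)
  clear huv
  obtain ⟨⟨c, r, k⟩, h⟩ := u
  obtain ⟨⟨c', r', k'⟩, h'⟩ := v
  simp only [leftDist, rightDist] at *
  rw [Prod.mk.injEq, Prod.mk.injEq]
  have hd := h
  have hd' := h'
  simp only [IsVertex] at hd hd'
  split_ifs at hL hR
  all_goals omega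

/-! ### Landmarks resolving the edges -/

theorem min_leftDist {p q : ℕ × ℕ × ℕ} (h : Arrow p q) :
    min (leftDist p) (leftDist q) =
      if p.1 = 0 ∧ p.2.1 = 0 ∧ p.2.2 ≠ 0 then 1 else p.1 + p.2.1 := by
  obtain ⟨c, r, k⟩ := p
  obtain ⟨x, y, z⟩ := q
  simp only [Arrow] at h
  simp only [leftDist]
  split_ifs <;> omega

theorem min_rightDist {p q : ℕ × ℕ × ℕ} (h : Arrow p q) (hp : p.1 ≤ 3 * n + 3)
    (hq : q.1 ≤ 3 * n + 3) :
    min (rightDist n p) (rightDist n q) =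
      if q.2.1 = p.2.1 then
        if q.1 = 3 * n + 3 ∧ q.2.1 = 0 ∧ q.2.2 ≠ 0 then 1 else 3 * n + 3 - q.1 + q.2.1
      else if p.1 = 3 * n + 3 ∧ p.2.1 = 0 ∧ p.2.2 ≠ 0 then 1 else 3 * n + 3 - p.1 + p.2.1 := by
  obtain ⟨c, r, k⟩ := p
  obtain ⟨x, y, z⟩ := q
  simp only [Arrow] at h
  simp only [rightDist] at *
  split_ifs <;> omega

theorem IsVertex.middle_ne {p : ℕ × ℕ × ℕ} (h : IsVertex n m p) (hp : p.2.1 = 1) :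
    p.1 ≠ 1 ∧ p.1 ≠ 3 * n + 2 := by
  simp only [IsVertex] at h
  omega

/-- Away from the extra corner clones, the two distances of an edge with upper or left end in row r
add up to 3n + 2 + 2r if it is horizontal and 3n + 3 + 2r if vertical. An edge at an extra clone
would only collide with an edge at a deleted vertex, excluded by `IsVertex.middle_ne`. -/
theorem coordinates_eq_of_dist_eq {p q p' q' : ℕ × ℕ × ℕ} (h : Arrow p q) (h' : Arrow p' q')
    (hp : IsVertex n m p) (hp' : IsVertex n m p') (hq : IsVertex n m q) (hq' : IsVertex n m q')
    (hL : min (leftDist p) (leftDist q) = min (leftDist p') (leftDist q'))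
    (hR : min (rightDist n p) (rightDist n q) = min (rightDist n p') (rightDist n q')) :
    p.1 = p'.1 ∧ p.2.1 = p'.2.1 ∧ q.1 = q'.1 ∧ q.2.1 = q'.2.1 := by
  rw [min_leftDist h, min_leftDist h'] at hL
  rw [min_rightDist h hp.1 hq.1, min_rightDist h' hp'.1 hq'.1] at hR
  have a := hp.1
  have a' := hp'.1
  have b := hq.1
  have b' := hq'.1
  have d := hp.middle_ne
  have d' := hp'.middle_ne
  have e := hq.middle_ne
  have e' := hq'.middle_ne
  clear hp hp' hq hq'
  obtain ⟨c, r, k⟩ := p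
  obtain ⟨c', r', k'⟩ := p'
  obtain ⟨x, y, z⟩ := q
  obtain ⟨x', y', z'⟩ := q'
  dsimp only [Arrow] at *
  rcases h with ⟨h1, h2, -⟩ | ⟨h1, h2, -⟩ <;> rcases h' with ⟨h1', h2', -⟩ | ⟨h1', h2', -⟩
  · rw [if_pos h1, if_pos h1'] at hR
    split_ifs at hL hR
    all_goals omega
  · rw [if_pos h1, if_neg (show ¬ y' = r' by omega)] at hR
    split_ifs at hL hR
    all_goals omega
  · rw [if_neg (show ¬ y = r by omega), if_pos h1'] at hR
    split_ifs at hL hR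
    all_goals omega
  · rw [if_neg (show ¬ y = r by omega), if_neg (show ¬ y' = r' by omega)] at hR
    split_ifs at hL hR
    all_goals omega

/-- Left clones are identified by `same`, right ones by `hR`, and split copies by the direction of
the edge. -/
theorem copy_eq_of_dist_eq {p q p' q' : ℕ × ℕ × ℕ} (h : Arrow p q) (h' : Arrow p' q')
    (hp : IsVertex n m p) (hp' : IsVertex n m p') (hq : IsVertex n m q) (hq' : IsVertex n m q')
    (coords : p.1 = p'.1 ∧ p.2.1 = p'.2.1 ∧ q.1 = q'.1 ∧ q.2.1 = q'.2.1)
    (same : ∀ k < m - 1, (p = (0, 0, k) ↔ p' = (0, 0, k)))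
    (hR : min (rightDist n p) (rightDist n q) = min (rightDist n p') (rightDist n q')) :
    p.2.2 = p'.2.2 ∧ q.2.2 = q'.2.2 := by
  rw [min_rightDist h hp.1 hq.1, min_rightDist h' hp'.1 hq'.1] at hR
  obtain ⟨c, r, k⟩ := p
  obtain ⟨c', r', k'⟩ := p'
  obtain ⟨x, y, z⟩ := q
  obtain ⟨x', y', z'⟩ := q'
  dsimp only at coords hR ⊢
  obtain ⟨rfl, rfl, rfl, rfl⟩ := coords
  have left : c = 0 → r = 0 → k = k' := by
    rintro rfl rfl
    have s1 := same k
    have s2 := same k'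
    simp only [IsVertex] at hp hp'
    simp at s1 s2
    omega
  have corner : ∀ {c k : ℕ}, IsVertex n m (c, 0, k) → c ≠ 0 → k = 0 ∨ c = 3 * n + 3 ∧ k = 1 := by
    intro c k h
    simp only [IsVertex] at h
    omega
  have middle : ∀ {c k : ℕ}, IsVertex n m (c, 1, k) → k = 0 ∨ k = 1 ∧ c % 3 = 0 := by
    intro c k h
    simp only [IsVertex] at h
    omega
  have bottom : ∀ {c k : ℕ}, IsVertex n m (c, 2, k) → k = 0 := by
    intro c k h
    simp only [IsVertex] at h
    omega
  have hr : r = 0 ∨ r = 1 ∨ r = 2 := by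
    simp only [IsVertex] at hp
    omega
  clear same
  simp only [Arrow] at h h'
  rcases h with ⟨rfl, rfl, h⟩ | ⟨rfl, rfl, h⟩
  · replace h' : y = 1 → k' + z' = 1 := by omega
    have := hq.1
    rw [if_pos rfl, if_pos rfl] at hR
    obtain rfl | rfl | rfl := hr
    · have a := corner hp
      have a' := corner hp'
      have b := corner hq
      have b' := corner hq'
      clear hp hp' hq hq' corner middle bottom
      dsimp only at *
      refine ⟨by omega, ?_⟩
      split_ifs at hR <;> omega
    -- Of two adjacent columns at most one is split, so the position tells which end is the copy
    -- `1`.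
    · have a := middle hp
      have a' := middle hp'
      have b := middle hq
      have b' := middle hq'
      omega
    · exact ⟨(bottom hp).trans (bottom hp').symm, (bottom hq).trans (bottom hq').symm⟩
  · replace h' : (r = 0 → z' = 0) ∧ (r = 1 → k' = 0) := by omega
    rw [if_neg (show ¬ r + 1 = r by omega), if_neg (show ¬ r + 1 = r by omega)] at hR
    obtain rfl | rfl | rfl := hr
    · have a := corner hp
      have a' := corner hp'
      clear hp hp' hq hq' corner middle bottom
      refine ⟨?_, by omega⟩
      split_ifs at hR <;> omega
    · exact ⟨(h.2 rfl).trans (h'.2 rfl).symm, (bottom hq).trans (bottom hq').symm⟩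
    · simp [IsVertex] at hq

theorem isEdgeMetricGenerator_cornerLandmarks (hm : 2 ≤ m) :
    (graph n m).IsEdgeMetricGenerator (cornerLandmarks n m) := by
  have orient : ∀ e ∈ (graph n m).edgeSet, ∃ u v : Vertex n m, Arrow u.1 v.1 ∧ e = s(u, v) := by
    intro e
    induction e using Sym2.ind with
    | _ u v =>
      rintro (h | h)
      · exact ⟨u, v, h, rfl⟩
      · exact ⟨v, u, h, Sym2.eq_swap⟩
  intro e he f hf hef
  obtain ⟨u, v, huv, rfl⟩ := orient e he
  obtain ⟨u', v', huv', rfl⟩ := orient f hf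
  by_contra! H
  have hm0 : 0 < m := by omega
  have hL := H _ (leftCorner_mem 0 (by omega))
  have hR := H _ rightCorner_mem
  rw [edgeDist_mk, edgeDist_mk] at hL hR
  simp only [dist_leftCorner] at hL
  simp only [dist_rightCorner] at hR
  have left : ∀ u v : Vertex n m, Arrow u.1 v.1 → ∀ (k : ℕ) (hk : k < m),
      ((graph n m).edgeDist s(u, v) (leftCorner k hk) = 0 ↔ u = leftCorner k hk) := by
    intro u v huv k hk
    rw [edgeDist_mk, Nat.min_eq_zero_iff, connected.dist_eq_zero_iff, connected.dist_eq_zero_iff]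
    -- No arrow ends at a left corner.
    refine or_iff_left ?_
    rintro rfl
    simp only [Arrow, leftCorner] at huv
    omega
  have same : ∀ k, k < m - 1 → (u.1 = (0, 0, k) ↔ u'.1 = (0, 0, k)) := by
    intro k hk
    have := left u v huv k (by omega)
    rw [H _ (leftCorner_mem k hk), left u' v' huv' k (by omega), Subtype.ext_iff,
      Subtype.ext_iff] at this
    exact this.symm
  clear left H orient
  have coords := coordinates_eq_of_dist_eq huv huv' u.2 u'.2 v.2 v'.2 hL hR
  have copies := copy_eq_of_dist_eq huv huv' u.2 u'.2 v.2 v'.2 coords same hR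
  have hu : u = u' := Subtype.ext (Prod.ext coords.1 (Prod.ext coords.2.1 copies.1))
  have hv : v = v' := Subtype.ext (Prod.ext coords.2.2.1 (Prod.ext coords.2.2.2 copies.2))
  exact hef (by rw [hu, hv])

theorem metricDim_graph (hm : 2 ≤ m) : (graph n m).metricDim = m + n := by
  refine Nat.sInf_eq_of_mem_of_le ⟨landmarks n m, isMetricGenerator_landmarks hm, rfl⟩
    (card_landmarks_le (by omega)) ?_
  rintro _ ⟨S, hS, rfl⟩
  exact le_card_of_isMetricGenerator (by omega) hS

theorem edgeMetricDim_graph (hm : 2 ≤ m) : (graph n m).edgeMetricDim = m := by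
  refine Nat.sInf_eq_of_mem_of_le
    ⟨cornerLandmarks n m, isEdgeMetricGenerator_cornerLandmarks hm, rfl⟩
    (card_cornerLandmarks_le (by omega)) ?_
  rintro _ ⟨S, hS, rfl⟩
  exact le_card_of_isEdgeMetricGenerator (by omega) hS

end SplitGrid

theorem theorem1 (a b : ℕ) (hb : 4 ≤ b) (hba : b < a) :
    ∃ (V : Type) (_ : Fintype V) (G : SimpleGraph V),
      G.IsTwoConnected ∧ G.metricDim = a ∧ G.edgeMetricDim = b := by
  refine ⟨SplitGrid.Vertex (a - b) b, Fintype.ofFinite _, SplitGrid.graph (a - b) b,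
    SplitGrid.isTwoConnected, ?_, SplitGrid.edgeMetricDim_graph (by omega)⟩
  rw [SplitGrid.metricDim_graph (by omega)]
  omega
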